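/- For $A\in M_n(\mathbb C)$ Hermitian let $\lambda_1(A)\ge\dots\ge\lambda_n(A)$ be its eigenvalues, counted with multiplicity, and let its spectral spread be $$\mathrm{Spr}^+(A)=\big(\lambda_i(A)-\lambda_{n-i+1}(A)\big)_{1\le i\le \lfloor n/2\rfloor}.$$ For $B\in M_n(\mathbb C)$ let $s(B)=(s_1(B)\ge\dots\ge s_n(B))$ be its singular values, i.e. the eigenvalues of $(B^*B)^{1/2}$ in non-increasing order. For $x,y\in\mathbb R^n$ let $xy=(x_iy_i)_{i}$ be the entrywise product, and write $x\prec_w y$ if $\sum_{i=1}^j x_i^{\downarrow}\le\sum_{i=1}^j y_i^{\downarrow}$ for all $1\le j\le n$, where $x^{\downarrow}$ is the vector $x$ rearranged in non-increasing order. Let $A\oplus A=\begin{pmatrix}A&0\\0&A\end{pmatrix}$, so that $\mathrm{Spr}^+(A\oplus A)\in\mathbb R^n$. **Theorem.** Let $A,X\in M_n(\mathbb C)$ be Hermitian and let $U=e^{iX}$. Then $$s(A-U^*AU)\prec_w s(X)\,\mathrm{Spr}^+(A\oplus A)\quad\text{and}\quad s(A-U^*AU)\prec_w s(A)\,\mathrm{Spr}^+(X\oplus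 X).$$ -/

import Mathlib

noncomputable section

namespace SpectralSpread

/-- The entries of a real vector `x` rearranged in non-increasing order. -/
def decr {k : ℕ} (x : Fin k → ℝ) : Fin k → ℝ :=
  fun i => x (Tuple.sort x i.rev)

/-- Submajorization of real vectors of the same length: every partial sum of the decreasing
rearrangement of `x` is at most the corresponding partial sum for `y`. -/
def SubmajEq {k : ℕ} (x y : Fin k → ℝ) : Prop :=
  ∀ j : Fin k, ∑ i ∈ Finset.Iic j, decr x i ≤ ∑ i ∈ Finset.Iic j, decr y i

/-- The vector `x`, completed by zeros to a vector of length `m` (used only for `k ≤ m`). -/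
def pad {k : ℕ} (m : ℕ) (x : Fin k → ℝ) : Fin m → ℝ :=
  fun i => if h : i.val < k then x ⟨i.val, h⟩ else 0

/-- Submajorization of real vectors of possibly different lengths: the shorter vector is completed
by zeros. (For different lengths this is meant for vectors with non-negative entries.) -/
def Submaj {k h : ℕ} (x : Fin k → ℝ) (y : Fin h → ℝ) : Prop :=
  SubmajEq (pad (max k h) x) (pad (max k h) y)

/-- Entrywise product of two vectors; the result has the smaller of the two lengths. -/
def entryMul {k r : ℕ} (x : Fin k → ℝ) (y : Fin r → ℝ) : Fin (min k r) → ℝ :=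
  fun i => x (Fin.castLE (min_le_left k r) i) * y (Fin.castLE (min_le_right k r) i)

/-- The singular values `s(B)`, counting multiplicities and in non-increasing order, of a matrix
with `r` columns: the eigenvalues of `(B* B)^(1/2)`. -/
def sv {k r : ℕ} (B : Matrix (Fin k) (Fin r) ℂ) : Fin r → ℝ :=
  fun i => (Matrix.toEuclideanLin B).singularValues i

/-- The full spectral spread: `i`-th largest eigenvalue minus `i`-th smallest eigenvalue, where
`eigenvalues₀` lists the eigenvalues with multiplicities in non-increasing order. -/
def spr {ι : Type*} [Fintype ι] [DecidableEq ι] {A : Matrix ι ι ℂ} (hA : A.IsHermitian) :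
    Fin (Fintype.card ι) → ℝ :=
  fun i => hA.eigenvalues₀ i - hA.eigenvalues₀ i.rev

/-- The spectral spread `Spr⁺(A)`: the first `⌊N / 2⌋` entries of the full spectral spread of
a Hermitian matrix of size `N`. -/
def sprPlus {ι : Type*} [Fintype ι] [DecidableEq ι] {A : Matrix ι ι ℂ} (hA : A.IsHermitian) :
    Fin (Fintype.card ι / 2) → ℝ :=
  fun i => spr hA (Fin.castLE (Nat.div_le_self _ 2) i)

/-- The block diagonal matrix `A ⊕ B`. -/
def dsum {ι κ : Type*} (A : Matrix ι ι ℂ) (B : Matrix κ κ ℂ) : Matrix (ι ⊕ κ) (ι ⊕ κ) ℂ :=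
  Matrix.fromBlocks A 0 0 B

theorem isHermitian_dsum {ι κ : Type*} {A : Matrix ι ι ℂ} {B : Matrix κ κ ℂ}
    (hA : A.IsHermitian) (hB : B.IsHermitian) : (dsum A B).IsHermitian :=
  Matrix.IsHermitian.fromBlocks hA (by simp) hB

end SpectralSpread

end

/-! The sum of the k largest singular values of `B` is attained as the trace of `B W` for some
contraction `W = R * coordProj (below n k) * S` of rank at most k (`sum_singularValues_eq_trace`).
Along t ↦ e^{-itX} A e^{itX} the derivative is a unitary conjugate of i(AX - XA), so a bound on
|tr((AX - XA) W)| uniform in such `W` passes to A - U*AU by the mean value inequality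
(`norm_trace_sub_conj_exp_mul_le`).

To bound the commutator, write A, modulo a scalar matrix, as a combination of spectral projections P
of rank p, and X as a combination of contractions Z of rank at most j, with eigenvalue and singular
value gaps as coefficients. Cyclicity turns each piece into tr(P(ZW - WZ)), which is at most min(2p,
2(n - p), j, k) in absolute value (`norm_trace_proj_commutator_le`). Summation by parts converts
this minimum into the sum of the first k entries of s(X) Spr⁺(A ⊕ A). Exchanging A and X only
changes the sign of the commutator, which gives the second inequality. -/

noncomputable section

namespace SpectralSpread

open Matrix Finset

/-! ### Spectral spread of A ⊕ A -/

section Spread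

open Polynomial in
theorem charpoly_sandwich_diagonal {n : ℕ} {A Q : Matrix (Fin n) (Fin n) ℂ} {a : ℕ → ℝ}
    (hQ : star Q * Q = 1) (hA : A = Q * diagonal (fun i : Fin n => (a i : ℂ)) * star Q) :
    A.charpoly = ∏ i ∈ range n, (X - C (a i : ℂ)) := by
  rw [hA, Matrix.charpoly_mul_comm, ← Matrix.mul_assoc, hQ, Matrix.one_mul, charpoly_diagonal,
    Fin.prod_univ_eq_prod_range fun i => X - C (a i : ℂ)]

theorem prod_range_two_mul_div_two {M : Type*} [CommMonoid M] (f : ℕ → M) (n : ℕ) :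
    ∏ i ∈ range (2 * n), f (i / 2) = (∏ i ∈ range n, f i) * ∏ i ∈ range n, f i := by
  induction n with
  | zero => simp
  | succ n ih =>
    rw [show 2 * (n + 1) = 2 * n + 1 + 1 by ring, prod_range_succ, prod_range_succ, ih,
      prod_range_succ, show (2 * n + 1) / 2 = n by omega, show 2 * n / 2 = n by omega]
    simp only [mul_comm, mul_left_comm]

open Polynomial in
theorem eigenvalues₀_eq_of_charpoly_eq {ι : Type*} [Fintype ι] [DecidableEq ι] {M : Matrix ι ι ℂ}
    (hM : M.IsHermitian) {b : ℕ → ℝ}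
    (hb : ∀ p q, p ≤ q → q < Fintype.card ι → b q ≤ b p)
    (h : M.charpoly = ∏ i ∈ range (Fintype.card ι), (X - C (b i : ℂ))) (i : Fin (Fintype.card ι)) :
    hM.eigenvalues₀ i = b i := by
  have hr : M.charpoly.roots =
      Multiset.map (fun i : Fin (Fintype.card ι) => (b i : ℂ)) Finset.univ.val := by
    rw [h, ← Fin.prod_univ_eq_prod_range fun i => X - C (b i : ℂ), Polynomial.roots_prod]
    · simp
    · simp [Finset.prod_ne_zero_iff, Polynomial.X_sub_C_ne_zero]
  have hl : List.ofFn hM.eigenvalues₀ =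
      List.ofFn fun i : Fin (Fintype.card ι) => b i := by
    rw [← hM.sort_roots_charpoly_eq_eigenvalues₀, hr]
    simp_rw [Fin.univ_val_map, Multiset.map_coe, List.map_ofFn, Function.comp_def,
      RCLike.re_eq_complex_re, Complex.ofReal_re, Multiset.coe_sort]
    apply List.mergeSort_of_pairwise
    simp_rw [decide_eq_true_eq, ← List.sortedGE_iff_pairwise]
    exact Antitone.sortedGE_ofFn fun p q hpq => hb p q hpq q.isLt
  exact congrFun (List.ofFn_injective hl) i

/-- Every eigenvalue of A occurs twice as often in A ⊕ A, so the ordered list becomes `a (i / 2)`;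
the reversed index 2n - 1 - i halves to n - 1 - i / 2. -/
theorem sprPlus_dsum_self_apply {n : ℕ} {A Q : Matrix (Fin n) (Fin n) ℂ} {a : ℕ → ℝ}
    (hA : A.IsHermitian) (hQ : star Q * Q = 1) (ha : ∀ p q, p ≤ q → q < n → a q ≤ a p)
    (e : A = Q * diagonal (fun i : Fin n => (a i : ℂ)) * star Q)
    (i : Fin (Fintype.card (Fin n ⊕ Fin n) / 2)) :
    sprPlus (isHermitian_dsum hA hA) i = a (i / 2) - a (n - 1 - i / 2) := by
  have hcard : Fintype.card (Fin n ⊕ Fin n) = 2 * n := by simp [two_mul]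
  have key := eigenvalues₀_eq_of_charpoly_eq (isHermitian_dsum hA hA) (b := fun i => a (i / 2))
    (fun p q hpq hq => ha _ _ (Nat.div_le_div_right hpq) (by omega))
    (by
      rw [hcard, prod_range_two_mul_div_two
          fun i => (Polynomial.X - Polynomial.C (a i : ℂ) : Polynomial ℂ),
        ← charpoly_sandwich_diagonal hQ e, dsum, charpoly_fromBlocks_zero₁₂])
  have hi := i.isLt
  simp only [sprPlus, spr, key, Fin.val_castLE, Fin.val_rev]
  congr 2
  omega

end Spread

/-! ### Submajorization of vectors already in decreasing order -/

section Rearrangement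

theorem decr_of_antitone {k : ℕ} {x : Fin k → ℝ} (hx : Antitone x) : decr x = x := by
  have h : x ∘ Fin.revPerm = x ∘ Tuple.sort x :=
    Tuple.comp_sort_eq_comp_iff_monotone.2 fun i j hij => hx (by simpa using hij)
  ext i
  have := congrFun h i.rev
  simpa [decr] using this.symm

theorem submaj_of_sum_range_le {k h : ℕ} (hkh : h = k) {x : Fin k → ℝ} {y : Fin h → ℝ}
    {f g : ℕ → ℝ} (hx : ∀ i, x i = f i) (hy : ∀ i, y i = g i)
    (hf : ∀ p q, p ≤ q → q < k → f q ≤ f p) (hg : ∀ p q, p ≤ q → q < k → g q ≤ g p)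
    (H : ∀ j, j ≤ k → ∑ i ∈ range j, f i ≤ ∑ i ∈ range j, g i) : Submaj x y := by
  subst hkh
  have hlt : ∀ i : Fin (max h h), i.val < h := fun i => i.isLt.trans_eq (max_self h)
  have hpad : ∀ (z : Fin h → ℝ) (u : ℕ → ℝ), (∀ i, z i = u i) →
      (∀ p q, p ≤ q → q < h → u q ≤ u p) → decr (pad (max h h) z) = fun i : Fin (max h h) => u i := by
    intro z u hz hu
    have e : pad (max h h) z = fun i : Fin (max h h) => u i := by
      ext i
      simp [pad, hlt i, hz]
    rw [e]
    exact decr_of_antitone fun p q hpq => hu _ _ hpq (hlt q)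
  intro j
  rw [hpad x f hx hf, hpad y g hy hg]
  have hsum : ∀ u : ℕ → ℝ, ∑ i ∈ Iic j, u i = ∑ i ∈ range (j + 1), u i := by
    intro u
    rw [Nat.range_succ_eq_Iic, ← Fin.map_valEmbedding_Iic, sum_map]
    rfl
  rw [hsum, hsum]
  exact H _ (hlt j)

end Rearrangement

open scoped Matrix.Norms.L2Operator

/-! ### Traces against contractions of bounded rank -/

section Contractions

variable {n : ℕ}

/-- The coordinate projection onto the indices in `s`. -/
def coordProj (s : Finset (Fin n)) : Matrix (Fin n) (Fin n) ℂ :=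
  diagonal fun i => if i ∈ s then 1 else 0

/-- The indices below `j`. -/
def below (n j : ℕ) : Finset (Fin n) := univ.filter fun i => i.val < j

theorem card_below {j : ℕ} (hj : j ≤ n) : (below n j).card = j := by
  simp [below, Fin.card_filter_val_lt, hj]

theorem norm_apply_le (K : Matrix (Fin n) (Fin n) ℂ) (i j : Fin n) : ‖K i j‖ ≤ ‖K‖ := by
  have h := l2_opNorm_mulVec K (EuclideanSpace.single j 1)
  have h2 := (PiLp.norm_apply_le (WithLp.toLp 2 (K *ᵥ (EuclideanSpace.single j (1 : ℂ)).ofLp)) i)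
  simpa using h2.trans h

theorem norm_diagonal_le_one {v : Fin n → ℂ} (hv : ∀ i, ‖v i‖ ≤ 1) :
    ‖(diagonal v : Matrix (Fin n) (Fin n) ℂ)‖ ≤ 1 := by
  rw [l2_opNorm_diagonal]
  exact (pi_norm_le_iff_of_nonneg zero_le_one).2 hv

theorem norm_one_le : ‖(1 : Matrix (Fin n) (Fin n) ℂ)‖ ≤ 1 := by
  rw [← diagonal_one]
  exact norm_diagonal_le_one (by simp)

theorem norm_coordProj_le (s : Finset (Fin n)) : ‖coordProj s‖ ≤ 1 :=
  norm_diagonal_le_one fun i => by split_ifs <;> simp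

theorem norm_two_coordProj_sub_one_le (s : Finset (Fin n)) :
    ‖coordProj s + coordProj s - 1‖ ≤ 1 := by
  rw [coordProj, ← diagonal_one, diagonal_add, diagonal_sub]
  exact norm_diagonal_le_one fun i => by split_ifs <;> norm_num

theorem norm_mul_le_one {K L : Matrix (Fin n) (Fin n) ℂ} (hK : ‖K‖ ≤ 1) (hL : ‖L‖ ≤ 1) :
    ‖K * L‖ ≤ 1 :=
  (norm_mul_le K L).trans (mul_le_one₀ hK (norm_nonneg _) hL)

theorem norm_le_one_of_star_mul_self {V : Matrix (Fin n) (Fin n) ℂ} (hV : star V * V = 1) :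
    ‖V‖ ≤ 1 := by
  have h : ‖V‖ * ‖V‖ ≤ 1 := by
    rw [← CStarRing.norm_star_mul_self, hV]
    exact norm_one_le
  nlinarith [norm_nonneg V]

theorem norm_star_le_one {V : Matrix (Fin n) (Fin n) ℂ} (hV : ‖V‖ ≤ 1) : ‖star V‖ ≤ 1 := by
  rwa [norm_star]

theorem norm_trace_coordProj_mul_le (s : Finset (Fin n)) {K : Matrix (Fin n) (Fin n) ℂ}
    (hK : ‖K‖ ≤ 1) : ‖(coordProj s * K).trace‖ ≤ s.card := by
  have h : (coordProj s * K).trace = ∑ i ∈ s, K i i := by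
    simp [coordProj, Matrix.trace, diagonal_mul, Finset.sum_ite_mem]
  rw [h]
  refine (norm_sum_le _ _).trans ?_
  simpa using sum_le_sum fun i (_ : i ∈ s) => (norm_apply_le K i i).trans hK

theorem norm_trace_sandwich_mul_le (s : Finset (Fin n)) {R S K : Matrix (Fin n) (Fin n) ℂ}
    (hR : ‖R‖ ≤ 1) (hS : ‖S‖ ≤ 1) (hK : ‖K‖ ≤ 1) :
    ‖(R * coordProj s * S * K).trace‖ ≤ s.card := by
  have h : (R * coordProj s * S * K).trace = (coordProj s * (S * K * R)).trace := by
    rw [Matrix.mul_assoc, Matrix.mul_assoc, Matrix.trace_mul_comm, Matrix.mul_assoc]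
  rw [h]
  exact norm_trace_coordProj_mul_le s (norm_mul_le_one (norm_mul_le_one hS hK) hR)

theorem one_sub_coordProj_below (p : ℕ) :
    (1 : Matrix (Fin n) (Fin n) ℂ) - coordProj (below n p) = coordProj (below n p)ᶜ := by
  rw [coordProj, coordProj, ← diagonal_one, diagonal_sub]
  congr 1
  ext i
  by_cases h : i ∈ below n p <;> simp [h]

/-- The trace of a commutator of two contractions against the orthogonal projection onto the first
`p` vectors of an orthonormal basis, bounded by the rank of the projection, of its complement and
of either contraction. -/
theorem norm_trace_proj_commutator_le {p j k : ℕ} (hp : p ≤ n) (hj : j ≤ n) (hk : k ≤ n)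
    {Q R S V T : Matrix (Fin n) (Fin n) ℂ} (hQ : star Q * Q = 1) (hQ' : Q * star Q = 1)
    (hR : ‖R‖ ≤ 1) (hS : ‖S‖ ≤ 1) (hV : ‖V‖ ≤ 1) (hT : ‖T‖ ≤ 1) :
    ‖(Q * coordProj (below n p) * star Q *
        ((V * coordProj (below n j) * T) * (R * coordProj (below n k) * S) -
          (R * coordProj (below n k) * S) * (V * coordProj (below n j) * T))).trace‖ ≤
      (min (min (2 * p) (2 * (n - p))) (min j k) : ℕ) := by
  set Z := V * coordProj (below n j) * T with hZ
  set W := R * coordProj (below n k) * S with hW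
  have nQ : ‖Q‖ ≤ 1 := norm_le_one_of_star_mul_self hQ
  have nQ' : ‖star Q‖ ≤ 1 := norm_star_le_one nQ
  have nZ : ‖Z‖ ≤ 1 := norm_mul_le_one (norm_mul_le_one hV (norm_coordProj_le _)) hT
  have nW : ‖W‖ ≤ 1 := norm_mul_le_one (norm_mul_le_one hR (norm_coordProj_le _)) hS
  have key : ∀ s : Finset (Fin n),
      ‖(Q * coordProj s * star Q * (Z * W - W * Z)).trace‖ ≤ 2 * (s.card : ℝ) := by
    intro s
    rw [Matrix.mul_sub, Matrix.trace_sub]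
    have h1 := norm_trace_sandwich_mul_le s nQ nQ' (norm_mul_le_one nZ nW)
    have h2 := norm_trace_sandwich_mul_le s nQ nQ' (norm_mul_le_one nW nZ)
    exact (norm_sub_le _ _).trans (by linarith)
  set P := Q * coordProj (below n p) * star Q with hP
  -- A commutator has trace zero, so P may be replaced by -(1 - P), of rank n - p.
  have hcompl : (P * (Z * W - W * Z)).trace =
      -(Q * coordProj (below n p)ᶜ * star Q * (Z * W - W * Z)).trace := by
    have : Q * coordProj (below n p)ᶜ * star Q = 1 - P := by
      rw [← one_sub_coordProj_below, Matrix.mul_sub, Matrix.sub_mul, Matrix.mul_one, hQ']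
    rw [this, Matrix.sub_mul, Matrix.trace_sub, Matrix.one_mul, Matrix.trace_sub,
      Matrix.trace_mul_comm Z W]
    ring
  -- For the same reason P may be replaced by P - 1/2 = Y/2. As Y is a contraction, this factor 1/2
  -- cancels the two terms of the commutator and leaves j and k instead of 2j and 2k.
  set Y := P + P - 1 with hY
  have nY : ‖Y‖ ≤ 1 := by
    have : Y = Q * (coordProj (below n p) + coordProj (below n p) - 1) * star Q := by
      rw [Matrix.mul_sub, Matrix.sub_mul, Matrix.mul_add, Matrix.add_mul, Matrix.mul_one, hQ']
    rw [this]
    exact norm_mul_le_one (norm_mul_le_one nQ (norm_two_coordProj_sub_one_le _)) nQ'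
  have hsym : (P * (Z * W - W * Z)).trace + (P * (Z * W - W * Z)).trace =
      (Y * (Z * W - W * Z)).trace := by
    rw [hY, Matrix.sub_mul, Matrix.add_mul, Matrix.trace_sub, Matrix.trace_add, Matrix.one_mul,
      Matrix.trace_sub (Z * W), Matrix.trace_mul_comm Z W]
    ring
  have hZb : ‖(Y * (Z * W - W * Z)).trace‖ ≤ 2 * (j : ℝ) := by
    have e : (Y * (Z * W - W * Z)).trace = (Z * (W * Y)).trace - (Z * (Y * W)).trace := by
      rw [Matrix.mul_sub, Matrix.trace_sub, Matrix.trace_mul_comm Y, Matrix.mul_assoc,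
        ← Matrix.mul_assoc Y W Z, Matrix.trace_mul_comm (Y * W)]
    have h1 := norm_trace_sandwich_mul_le (below n j) hV hT (norm_mul_le_one nW nY)
    have h2 := norm_trace_sandwich_mul_le (below n j) hV hT (norm_mul_le_one nY nW)
    rw [card_below hj] at h1 h2
    rw [e]
    exact (norm_sub_le _ _).trans (by linarith)
  have hWb : ‖(Y * (Z * W - W * Z)).trace‖ ≤ 2 * (k : ℝ) := by
    have e : (Y * (Z * W - W * Z)).trace = (W * (Y * Z)).trace - (W * (Z * Y)).trace := by
      rw [Matrix.mul_sub, Matrix.trace_sub, ← Matrix.mul_assoc Y Z W,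
        Matrix.trace_mul_comm (Y * Z), Matrix.trace_mul_comm Y, Matrix.mul_assoc W Z Y]
    have h1 := norm_trace_sandwich_mul_le (below n k) hR hS (norm_mul_le_one nY nZ)
    have h2 := norm_trace_sandwich_mul_le (below n k) hR hS (norm_mul_le_one nZ nY)
    rw [card_below hk] at h1 h2
    rw [e]
    exact (norm_sub_le _ _).trans (by linarith)
  have hnorm : ‖(Y * (Z * W - W * Z)).trace‖ = 2 * ‖(P * (Z * W - W * Z)).trace‖ := by
    rw [← hsym, ← two_mul, norm_mul]
    simp
  have h1 := key (below n p)
  have h2 := key (below n p)ᶜ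
  rw [card_below hp] at h1
  rw [card_compl, card_below hp, Fintype.card_fin, ← norm_neg, ← hcompl] at h2
  push_cast
  refine le_min (le_min h1 h2) (le_min ?_ ?_) <;> linarith

end Contractions

/-! ### Summation by parts -/

section Summation

theorem sum_range_ite_mem_Ico {M : Type*} [AddCommGroup M] (f : ℕ → M) {l u n : ℕ} (h : l ≤ u)
    (hu : u ≤ n) :
    (∑ j ∈ range n, if j ∈ Ico l u then f j - f (j + 1) else 0) = f l - f u := by
  rw [← Finset.sum_filter, Finset.filter_mem_eq_inter, Finset.inter_eq_right.2]
  · rw [← neg_inj, ← sum_neg_distrib, neg_sub, ← sum_Ico_sub f h]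
    simp
  · intro x hx
    rw [mem_Ico] at hx
    rw [mem_range]
    omega

/-- Raising m by one raises the minimum by one exactly for m / 2 ≤ p < n - 1 - m / 2, and the gaps
of `a` over this interval telescope. The term p = n - 1 has weight zero, so `a n` is immaterial. -/
theorem sum_diff_mul_min {n : ℕ} (a : ℕ → ℝ) {m : ℕ} (hm : m ≤ n) :
    ∑ p ∈ range n, (a p - a (p + 1)) * ((min (min (2 * (p + 1)) (2 * (n - (p + 1)))) m : ℕ) : ℝ) =
      ∑ i ∈ range m, (a (i / 2) - a (n - 1 - i / 2)) := by
  induction m with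
  | zero => simp
  | succ m ih =>
    rw [sum_range_succ, ← ih (by omega)]
    have h : a (m / 2) - a (n - 1 - m / 2) =
        ∑ p ∈ range n, if p ∈ Ico (m / 2) (n - 1 - m / 2) then a p - a (p + 1) else 0 :=
      (sum_range_ite_mem_Ico a (by omega) (by omega)).symm
    rw [h, ← sum_add_distrib]
    refine sum_congr rfl fun p hp => ?_
    rw [mem_range] at hp
    split_ifs with hc
    · rw [mem_Ico] at hc
      have : min (min (2 * (p + 1)) (2 * (n - (p + 1)))) (m + 1) =
        min (min (2 * (p + 1)) (2 * (n - (p + 1)))) m + 1 := by omega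
      rw [this]; push_cast; ring
    · rw [mem_Ico] at hc
      have : min (min (2 * (p + 1)) (2 * (n - (p + 1)))) (m + 1) =
        min (min (2 * (p + 1)) (2 * (n - (p + 1)))) m := by omega
      rw [this, add_zero]

/-- The entry `g k` is counted by the indices j ≥ k, whose gaps telescope to `s k` because `s n =
0`. -/
theorem sum_diff_mul_sum_min {n : ℕ} {s : ℕ → ℝ} (hs : s n = 0) (g : ℕ → ℝ) {k : ℕ}
    (hk : k ≤ n) :
    ∑ j ∈ range n, (s j - s (j + 1)) * ∑ i ∈ range (min (j + 1) k), g i =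
      ∑ i ∈ range k, s i * g i := by
  induction k with
  | zero => simp
  | succ k ih =>
    rw [sum_range_succ, ← ih (by omega)]
    have h : s k = ∑ j ∈ range n, if j ∈ Ico k n then s j - s (j + 1) else 0 := by
      rw [sum_range_ite_mem_Ico s (by omega) le_rfl, hs, sub_zero]
    rw [h, sum_mul, ← sum_add_distrib]
    refine sum_congr rfl fun j hj => ?_
    rw [mem_range] at hj
    split_ifs with hc
    · rw [mem_Ico] at hc
      rw [show min (j + 1) (k + 1) = k + 1 by omega, show min (j + 1) k = k by omega,
        sum_range_succ]
      ring
    · rw [mem_Ico] at hc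
      rw [show min (j + 1) (k + 1) = min (j + 1) k by omega]
      ring

theorem diagonal_eq_sum_coordProj {n : ℕ} (v : ℕ → ℝ) :
    (diagonal fun i : Fin n => (v i : ℂ)) =
      ∑ j ∈ range n, (v j - v (j + 1) : ℂ) • coordProj (below n (j + 1)) +
        (v n : ℂ) • (1 : Matrix (Fin n) (Fin n) ℂ) := by
  have h : ∀ i : Fin n, (v i : ℂ) =
      ∑ j ∈ range n, (if (i : ℕ) < j + 1 then (v j - v (j + 1) : ℂ) else 0) + v n := by
    intro i
    have h := sum_range_ite_mem_Ico (fun j => (v j : ℂ)) i.isLt.le (le_refl n)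
    rw [eq_comm, ← eq_sub_iff_add_eq, ← h]
    refine sum_congr rfl fun j hj => ?_
    rw [mem_range] at hj
    congr 1
    simp [mem_Ico, hj]
  ext i l
  by_cases hil : i = l
  · subst hil
    rw [diagonal_apply_eq, h i]
    simp [Matrix.sum_apply, coordProj, below]
  · simp [Matrix.sum_apply, coordProj, hil]

end Summation

/-! ### Spectral and singular value decompositions -/

section Decompositions

variable {n : ℕ}

/-- The matrix whose columns are the vectors of an orthonormal basis. -/
def colMatrix (b : OrthonormalBasis (Fin n) ℂ (EuclideanSpace ℂ (Fin n))) :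
    Matrix (Fin n) (Fin n) ℂ :=
  Matrix.of fun i j => b j i

theorem star_colMatrix_mul_self (b : OrthonormalBasis (Fin n) ℂ (EuclideanSpace ℂ (Fin n))) :
    star (colMatrix b) * colMatrix b = 1 :=
  (EuclideanSpace.basisFun (Fin n) ℂ).toMatrix_orthonormalBasis_conjTranspose_mul_self b

theorem colMatrix_mul_star_self (b : OrthonormalBasis (Fin n) ℂ (EuclideanSpace ℂ (Fin n))) :
    colMatrix b * star (colMatrix b) = 1 :=
  mul_eq_one_comm.1 (star_colMatrix_mul_self b)

theorem eq_colMatrix_mul_diagonal_mul_star {B : Matrix (Fin n) (Fin n) ℂ}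
    {u v : OrthonormalBasis (Fin n) ℂ (EuclideanSpace ℂ (Fin n))} {s : Fin n → ℂ}
    (h : ∀ i, toEuclideanLin B (v i) = s i • u i) :
    B = colMatrix u * diagonal s * star (colMatrix v) := by
  have e : B * colMatrix v = colMatrix u * diagonal s := by
    ext i j
    have := congrArg (fun w : EuclideanSpace ℂ (Fin n) => w i) (h j)
    rw [Matrix.mul_diagonal, mul_comm]
    simpa [Matrix.mul_apply, Matrix.mulVec, dotProduct, colMatrix] using this
  rw [← e, Matrix.mul_assoc, colMatrix_mul_star_self, Matrix.mul_one]

/-- Spectral decomposition with eigenvalues listed in non-increasing order. -/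
theorem exists_spectral_decomposition {A : Matrix (Fin n) (Fin n) ℂ} (hA : A.IsHermitian) :
    ∃ (Q : Matrix (Fin n) (Fin n) ℂ) (a : ℕ → ℝ), star Q * Q = 1 ∧ Q * star Q = 1 ∧
      (∀ p q, p ≤ q → q < n → a q ≤ a p) ∧
      A = Q * diagonal (fun i : Fin n => (a i : ℂ)) * star Q := by
  have hT := isSymmetric_toEuclideanLin_iff.mpr hA
  have hn : Module.finrank ℂ (EuclideanSpace ℂ (Fin n)) = n := finrank_euclideanSpace_fin
  refine ⟨colMatrix (hT.eigenvectorBasis hn),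
    fun p => if h : p < n then hT.eigenvalues hn ⟨p, h⟩ else 0,
    star_colMatrix_mul_self _, colMatrix_mul_star_self _, ?_, ?_⟩
  · intro p q hpq hq
    simp only [hq, hpq.trans_lt hq, dif_pos]
    exact hT.eigenvalues_antitone hn hpq
  · apply eq_colMatrix_mul_diagonal_mul_star
    intro i
    simp

/-- Singular value decomposition. -/
theorem exists_singular_value_decomposition (B : Matrix (Fin n) (Fin n) ℂ) :
    ∃ V T : Matrix (Fin n) (Fin n) ℂ, star V * V = 1 ∧ star T * T = 1 ∧ T * star T = 1 ∧
      B = V * diagonal (fun i : Fin n => ((toEuclideanLin B).singularValues i : ℂ)) * T := by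
  set L := toEuclideanLin B with hL
  have hn : Module.finrank ℂ (EuclideanSpace ℂ (Fin n)) = n := finrank_euclideanSpace_fin
  set v := L.isSymmetric_adjoint_comp_self.eigenvectorBasis hn with hv
  have hinner : ∀ i j, inner ℂ (L (v i)) (L (v j)) =
      if i = j then ((L.singularValues j : ℂ)) ^ 2 else 0 := by
    intro i j
    have h := L.isSymmetric_adjoint_comp_self.apply_eigenvectorBasis hn j
    rw [← L.sq_singularValues_fin hn j, ← hv] at h
    rw [← LinearMap.adjoint_inner_right, ← LinearMap.comp_apply, h, inner_smul_right,
      orthonormal_iff_ite.1 v.orthonormal i j]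
    simp
  -- Normalized images are orthonormal where the singular value is nonzero; the remaining left
  -- singular vectors are arbitrary, supplied by extension to a basis.
  set w : Fin n → EuclideanSpace ℂ (Fin n) := fun i => ((L.singularValues i : ℂ))⁻¹ • L (v i)
    with hw
  have horth : Orthonormal ℂ (({i | L.singularValues i ≠ 0} : Set (Fin n)).domRestrict w) := by
    rw [orthonormal_iff_ite]
    rintro ⟨i, hi⟩ ⟨j, hj⟩
    simp only [Set.domRestrict_apply, hw, inner_smul_left, inner_smul_right, hinner,
      Subtype.mk.injEq]
    split_ifs with hij
    · subst hij
      have : (L.singularValues i : ℂ) ≠ 0 := by exact_mod_cast hi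
      simp
      field_simp
    · simp
  obtain ⟨u, hu⟩ := horth.exists_orthonormalBasis_extension_of_card_eq (by simp)
  refine ⟨colMatrix u, star (colMatrix v), star_colMatrix_mul_self _, ?_, ?_, ?_⟩
  · rw [star_star, colMatrix_mul_star_self]
  · rw [star_star, star_colMatrix_mul_self]
  · apply eq_colMatrix_mul_diagonal_mul_star
    intro i
    by_cases hi : L.singularValues i = 0
    · have h := hinner i i
      rw [if_pos rfl, hi] at h
      have : L (v i) = 0 := by simpa using h
      rw [this, hi]
      simp
    · have : (L.singularValues i : ℂ) ≠ 0 := by exact_mod_cast hi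
      rw [hu i hi, hw, smul_smul, mul_inv_cancel₀ this, one_smul]

end Decompositions

/-! ### Trace bound for the commutator -/

section Commutator

variable {n : ℕ}

theorem sandwich_diagonal_eq_sum (V T : Matrix (Fin n) (Fin n) ℂ) (v : ℕ → ℝ) :
    V * diagonal (fun i : Fin n => (v i : ℂ)) * T =
      ∑ j ∈ range n, ((v j - v (j + 1) : ℝ) : ℂ) • (V * coordProj (below n (j + 1)) * T) +
        (v n : ℂ) • (V * T) := by
  rw [diagonal_eq_sum_coordProj]
  simp [Matrix.mul_add, Matrix.add_mul, Matrix.mul_sum, Matrix.sum_mul]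

theorem norm_trace_commutator_mul_le {Q V T R S : Matrix (Fin n) (Fin n) ℂ} {a s : ℕ → ℝ} {k : ℕ}
    (hk : k ≤ n) (hQ : star Q * Q = 1) (hQ' : Q * star Q = 1)
    (hV : ‖V‖ ≤ 1) (hT : ‖T‖ ≤ 1) (hR : ‖R‖ ≤ 1) (hS : ‖S‖ ≤ 1)
    (ha : ∀ p q, p ≤ q → q < n → a q ≤ a p) (hs : Antitone s) (hsn : s n = 0)
    {A X : Matrix (Fin n) (Fin n) ℂ}
    (hA : A = Q * diagonal (fun i : Fin n => (a i : ℂ)) * star Q)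
    (hX : X = V * diagonal (fun i : Fin n => (s i : ℂ)) * T) :
    ‖((A * X - X * A) * (R * coordProj (below n k) * S)).trace‖ ≤
      ∑ i ∈ range k, s i * (a (i / 2) - a (n - 1 - i / 2)) := by
  set W := R * coordProj (below n k) * S with hW
  set P : ℕ → Matrix (Fin n) (Fin n) ℂ := fun p => Q * coordProj (below n (p + 1)) * star Q with hP
  set Z : ℕ → Matrix (Fin n) (Fin n) ℂ := fun j => V * coordProj (below n (j + 1)) * T with hZ
  have eA : A = ∑ p ∈ range n, ((a p - a (p + 1) : ℝ) : ℂ) • P p + (a n : ℂ) • 1 := by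
    rw [hA, sandwich_diagonal_eq_sum, hQ']
  have eX : X = ∑ j ∈ range n, ((s j - s (j + 1) : ℝ) : ℂ) • Z j := by
    rw [hX, sandwich_diagonal_eq_sum, hsn]
    simp [hZ]
  have e1 : ((A * X - X * A) * W).trace = (A * (X * W - W * X)).trace := by
    rw [Matrix.sub_mul, Matrix.trace_sub, Matrix.mul_sub, Matrix.trace_sub, Matrix.mul_assoc,
      Matrix.mul_assoc X A W, Matrix.trace_mul_comm X, Matrix.mul_assoc]
  have e2 : (A * (X * W - W * X)).trace =
      ∑ p ∈ range n, ((a p - a (p + 1) : ℝ) : ℂ) * (P p * (X * W - W * X)).trace := by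
    conv_lhs => rw [eA]
    rw [Matrix.add_mul, Matrix.trace_add, Matrix.smul_mul, Matrix.one_mul, Matrix.trace_smul,
      Matrix.trace_sub, Matrix.trace_mul_comm X W, sub_self, smul_zero, add_zero, Matrix.sum_mul,
      Matrix.trace_sum]
    simp only [Matrix.smul_mul, Matrix.trace_smul, smul_eq_mul]
  have e3 : X * W - W * X =
      ∑ j ∈ range n, ((s j - s (j + 1) : ℝ) : ℂ) • (Z j * W - W * Z j) := by
    rw [eX, Matrix.sum_mul, Matrix.mul_sum, ← Finset.sum_sub_distrib]
    simp only [Matrix.smul_mul, Matrix.mul_smul, smul_sub]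
  have e4 : ∀ p, (P p * (X * W - W * X)).trace =
      ∑ j ∈ range n, ((s j - s (j + 1) : ℝ) : ℂ) * (P p * (Z j * W - W * Z j)).trace := by
    intro p
    rw [e3, Matrix.mul_sum, Matrix.trace_sum]
    simp only [Matrix.mul_smul, Matrix.trace_smul, smul_eq_mul]
  rw [e1, e2]
  simp only [e4, Finset.mul_sum]
  calc
    _ ≤ ∑ p ∈ range n, ∑ j ∈ range n, (s j - s (j + 1)) * ((a p - a (p + 1)) *
          ((min (min (2 * (p + 1)) (2 * (n - (p + 1)))) (min (j + 1) k) : ℕ) : ℝ)) := by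
      refine (norm_sum_le _ _).trans (sum_le_sum fun p hp => ?_)
      refine (norm_sum_le _ _).trans (sum_le_sum fun j hj => ?_)
      rw [mem_range] at hp hj
      have hb := norm_trace_proj_commutator_le (Nat.succ_le_of_lt hp) (Nat.succ_le_of_lt hj) hk
        hQ hQ' hR hS hV hT
      have hsj : 0 ≤ s j - s (j + 1) := sub_nonneg.2 (hs (Nat.le_succ j))
      rw [norm_mul, norm_mul, Complex.norm_real, Complex.norm_real, Real.norm_eq_abs,
        Real.norm_eq_abs, abs_of_nonneg hsj, mul_left_comm]
      refine mul_le_mul_of_nonneg_left ?_ hsj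
      rcases (Nat.succ_le_of_lt hp).lt_or_eq with h | h
      · rw [abs_of_nonneg (sub_nonneg.2 (ha p (p + 1) (Nat.le_succ p) h))]
        exact mul_le_mul_of_nonneg_left hb (sub_nonneg.2 (ha p (p + 1) (Nat.le_succ p) h))
      -- At p = n - 1 the gap `a p - a (p + 1)` has no known sign, but the projection is the
      -- identity and the trace vanishes.
      · have h0 : min (min (2 * (p + 1)) (2 * (n - (p + 1)))) (min (j + 1) k) = 0 := by omega
        rw [Nat.succ_eq_add_one, Nat.succ_eq_add_one, h0, Nat.cast_zero] at hb
        have := le_antisymm hb (norm_nonneg _)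
        rw [h0, Nat.cast_zero, mul_zero]
        exact (mul_eq_zero_of_right _ this).le
    _ = ∑ j ∈ range n, (s j - s (j + 1)) *
          ∑ i ∈ range (min (j + 1) k), (a (i / 2) - a (n - 1 - i / 2)) := by
      rw [sum_comm]
      refine sum_congr rfl fun j _ => ?_
      rw [← Finset.mul_sum, sum_diff_mul_min a ((min_le_right _ _).trans hk)]
    _ = _ := sum_diff_mul_sum_min hsn _ hk

end Commutator

/-! ### From the commutator to conjugation by e^{iX} -/

section Exponential

variable {n : ℕ}

theorem star_exp_I_smul {X : Matrix (Fin n) (Fin n) ℂ} (hX : X.IsHermitian) (t : ℝ) :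
    star (NormedSpace.exp (t • (Complex.I • X))) = NormedSpace.exp (t • -(Complex.I • X)) := by
  rw [star_eq_conjTranspose, ← Matrix.exp_conjTranspose, conjTranspose_smul, conjTranspose_smul,
    hX.eq]
  simp

theorem exp_neg_mul_exp (Y : Matrix (Fin n) (Fin n) ℂ) (t : ℝ) :
    NormedSpace.exp (t • -Y) * NormedSpace.exp (t • Y) = 1 := by
  rw [← Matrix.exp_add_of_commute _ _ (by rw [smul_neg]; exact (Commute.refl _).neg_left),
    smul_neg, neg_add_cancel, NormedSpace.exp_zero]

theorem norm_trace_sub_conj_exp_mul_le {A X R S : Matrix (Fin n) (Fin n) ℂ} {k : ℕ} {c : ℝ}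
    (hX : X.IsHermitian) (hR : ‖R‖ ≤ 1) (hS : ‖S‖ ≤ 1)
    (hc : ∀ R' S' : Matrix (Fin n) (Fin n) ℂ, ‖R'‖ ≤ 1 → ‖S'‖ ≤ 1 →
      ‖((A * X - X * A) * (R' * coordProj (below n k) * S')).trace‖ ≤ c) :
    ‖((A - (NormedSpace.exp (Complex.I • X))ᴴ * A * NormedSpace.exp (Complex.I • X)) *
      (R * coordProj (below n k) * S)).trace‖ ≤ c := by
  set Y := Complex.I • X with hY
  set W := R * coordProj (below n k) * S with hW
  set tr : Matrix (Fin n) (Fin n) ℂ →L[ℝ] ℂ :=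
    LinearMap.toContinuousLinearMap (Matrix.traceLinearMap (Fin n) ℝ ℂ) with htr
  have htr' : ∀ M, tr M = M.trace := fun M => rfl
  set f : ℝ → ℂ := fun t =>
    tr (NormedSpace.exp (t • -Y) * A * NormedSpace.exp (t • Y) * W) with hf
  set f' : ℝ → ℂ := fun t => tr ((NormedSpace.exp (t • -Y) * -Y * A * NormedSpace.exp (t • Y) +
    NormedSpace.exp (t • -Y) * A * (Y * NormedSpace.exp (t • Y))) * W) with hf'
  have hd : ∀ t, HasDerivAt f (f' t) t := by
    intro t
    have h1 : HasDerivAt (fun u : ℝ => NormedSpace.exp (u • -Y))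
      (NormedSpace.exp (t • -Y) * -Y) t := hasDerivAt_exp_smul_const (-Y) t
    have h2 : HasDerivAt (fun u : ℝ => NormedSpace.exp (u • Y))
      (Y * NormedSpace.exp (t • Y)) t := hasDerivAt_exp_smul_const' Y t
    exact tr.hasFDerivAt.comp_hasDerivAt t (((h1.mul_const A).mul h2).mul_const W)
  have hbound : ∀ t, ‖f' t‖ ≤ c := by
    intro t
    set E := NormedSpace.exp (t • Y) with hE
    set F := NormedSpace.exp (t • -Y) with hF
    have hEF : star E = F := star_exp_I_smul hX t
    have nE : ‖E‖ ≤ 1 := norm_le_one_of_star_mul_self (by rw [hEF]; exact exp_neg_mul_exp Y t)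
    have nF : ‖F‖ ≤ 1 := by rw [← hEF]; exact norm_star_le_one nE
    -- By cyclicity the unitaries E and F are absorbed into the outer factors of `W`, which stay
    -- contractions; this is why `hc` quantifies over all of them.
    have e : f' t = Complex.I *
        ((A * X - X * A) * ((E * R) * coordProj (below n k) * (S * F))).trace := by
      have e1 : (F * -Y * A * E + F * A * (Y * E)) * W =
          Complex.I • (F * ((A * X - X * A) * (E * W))) := by
        simp only [hY, Matrix.mul_neg, Matrix.neg_mul, Matrix.mul_smul,
          Matrix.smul_mul, Matrix.mul_sub, Matrix.sub_mul, Matrix.add_mul, Matrix.mul_assoc,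
          smul_sub]
        abel
      rw [hf']
      simp only [htr']
      rw [e1, Matrix.trace_smul, smul_eq_mul, Matrix.trace_mul_comm, hW]
      simp only [Matrix.mul_assoc]
    rw [e, norm_mul, Complex.norm_I, one_mul]
    exact hc _ _ (norm_mul_le_one nE hR) (norm_mul_le_one hS nF)
  have hmv := norm_image_sub_le_of_norm_deriv_le_segment_01'
    (fun t _ => (hd t).hasDerivWithinAt) (fun t _ => hbound t)
  have h1 : NormedSpace.exp (-Y) = (NormedSpace.exp Y)ᴴ := by
    simpa [star_eq_conjTranspose] using (star_exp_I_smul hX 1).symm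
  rw [norm_sub_rev] at hmv
  simpa [hf, htr', ← Matrix.trace_sub, ← Matrix.sub_mul, h1] using hmv

/-- With B = V d T, the choice R = T*, S = V* cancels the unitary factors and leaves the trace of d
cut off at k. -/
theorem sum_singularValues_eq_trace (B : Matrix (Fin n) (Fin n) ℂ) {k : ℕ} (hk : k ≤ n) :
    ∃ R S : Matrix (Fin n) (Fin n) ℂ, ‖R‖ ≤ 1 ∧ ‖S‖ ≤ 1 ∧
      (B * (R * coordProj (below n k) * S)).trace =
        ((∑ i ∈ range k, (toEuclideanLin B).singularValues i : ℝ) : ℂ) := by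
  obtain ⟨V, T, hV, hT, hT', hB⟩ := exists_singular_value_decomposition B
  refine ⟨star T, star V, norm_star_le_one (norm_le_one_of_star_mul_self hT),
    norm_star_le_one (norm_le_one_of_star_mul_self hV), ?_⟩
  set d := diagonal (fun i : Fin n => ((toEuclideanLin B).singularValues i : ℂ)) with hd
  have e : (B * (star T * coordProj (below n k) * star V)).trace =
      (d * coordProj (below n k)).trace := by
    rw [hB]
    calc (V * d * T * (star T * coordProj (below n k) * star V)).trace
        = (V * (d * (T * star T) * coordProj (below n k) * star V)).trace := by
          simp only [Matrix.mul_assoc]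
      _ = (d * coordProj (below n k) * (star V * V)).trace := by
          rw [hT', Matrix.mul_one, Matrix.trace_mul_comm]
          simp only [Matrix.mul_assoc]
      _ = _ := by rw [hV, Matrix.mul_one]
  rw [e, hd, coordProj, diagonal_mul_diagonal, trace_diagonal]
  have h := Fin.sum_univ_eq_sum_range (fun i => if i < k then
    ((toEuclideanLin B).singularValues i : ℂ) else 0) n
  have h2 : (range n).filter (fun i => i < k) = range k := by
    ext i
    simp only [mem_filter, mem_range]
    omega
  rw [← Finset.sum_filter, ← Finset.sum_filter, h2] at h
  push_cast
  rw [← h]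
  simp [below, Finset.sum_filter]

end Exponential

/-! ### Assembling the submajorization -/

section Main

variable {n : ℕ}

/-- A matrix whose traces against contractions of rank at most `k` are controlled by those of the
commutator `A X - X A` has singular values submajorized by `s(X) Spr⁺(A ⊕ A)`. -/
theorem submaj_sv_entryMul_sprPlus {A X B : Matrix (Fin n) (Fin n) ℂ} (hA : A.IsHermitian)
    (H : ∀ (k : ℕ) (c : ℝ), (∀ R S : Matrix (Fin n) (Fin n) ℂ, ‖R‖ ≤ 1 → ‖S‖ ≤ 1 →
        ‖((A * X - X * A) * (R * coordProj (below n k) * S)).trace‖ ≤ c) →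
      ∀ R S : Matrix (Fin n) (Fin n) ℂ, ‖R‖ ≤ 1 → ‖S‖ ≤ 1 →
        ‖(B * (R * coordProj (below n k) * S)).trace‖ ≤ c) :
    Submaj (sv B) (entryMul (sv X) (sprPlus (isHermitian_dsum hA hA))) := by
  obtain ⟨Q, a, hQ, hQ', ha, eA⟩ := exists_spectral_decomposition hA
  obtain ⟨V, T, hV, hT, -, eX⟩ := exists_singular_value_decomposition X
  set s : ℕ → ℝ := fun i => (toEuclideanLin X).singularValues i with hs
  have hs_anti : Antitone s := (toEuclideanLin X).singularValues_antitone
  have hs_nonneg : ∀ i, 0 ≤ s i := (toEuclideanLin X).singularValues_nonneg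
  have hsn : s n = 0 :=
    (toEuclideanLin X).singularValues_of_finrank_le (finrank_euclideanSpace_fin).le
  have hcard : Fintype.card (Fin n ⊕ Fin n) = 2 * n := by simp [two_mul]
  refine submaj_of_sum_range_le (by omega) (f := fun i => (toEuclideanLin B).singularValues i)
    (g := fun i => s i * (a (i / 2) - a (n - 1 - i / 2))) (fun i => rfl) (fun i => ?_)
    (fun p q hpq _ => (toEuclideanLin B).singularValues_antitone hpq) (fun p q hpq hq => ?_)
    (fun k hk => ?_)
  · rw [entryMul, sprPlus_dsum_self_apply hA hQ ha eA]
    rfl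
  -- The product is non-increasing because both factors are non-increasing and non-negative; `h1`
  -- gives the sign of the spread.
  · have h1 := ha (q / 2) (n - 1 - q / 2) (by omega) (by omega)
    have h2 := ha (p / 2) (q / 2) (by omega) (by omega)
    have h3 := ha (n - 1 - q / 2) (n - 1 - p / 2) (by omega) (by omega)
    exact mul_le_mul (hs_anti hpq) (by linarith) (by linarith) (hs_nonneg p)
  · obtain ⟨R, S, hR, hS, e⟩ := sum_singularValues_eq_trace B hk
    have hb := H k _ (fun R' S' hR' hS' => norm_trace_commutator_mul_le hk hQ hQ'
      (norm_le_one_of_star_mul_self hV) (norm_le_one_of_star_mul_self hT) hR' hS' ha hs_anti hsn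
      eA eX) R S hR hS
    rw [e, Complex.norm_real] at hb
    exact (Real.le_norm_self _).trans hb

end Main

end SpectralSpread

end

theorem theorem3p4 {n : ℕ} (A X U : Matrix (Fin n) (Fin n) ℂ)
    (hA : A.IsHermitian) (hX : X.IsHermitian)
    (hU : U = NormedSpace.exp (Complex.I • X)) :
    SpectralSpread.Submaj
        (SpectralSpread.sv (A - U.conjTranspose * A * U))
        (SpectralSpread.entryMul (SpectralSpread.sv X)
          (SpectralSpread.sprPlus (SpectralSpread.isHermitian_dsum hA hA))) ∧
      SpectralSpread.Submaj
        (SpectralSpread.sv (A - U.conjTranspose * A * U))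
        (SpectralSpread.entryMul (SpectralSpread.sv A)
          (SpectralSpread.sprPlus (SpectralSpread.isHermitian_dsum hX hX))) := by
  subst hU
  refine ⟨SpectralSpread.submaj_sv_entryMul_sprPlus hA fun k c hc R S hR hS =>
      SpectralSpread.norm_trace_sub_conj_exp_mul_le hX hR hS hc,
    SpectralSpread.submaj_sv_entryMul_sprPlus hX fun k c hc R S hR hS =>
      SpectralSpread.norm_trace_sub_conj_exp_mul_le hX hR hS fun R' S' hR' hS' => ?_⟩
  -- The roles of A and X are exchanged here: XA - AX = -(AX - XA).
  have := hc R' S' hR' hS'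
  rwa [← neg_sub, Matrix.neg_mul, Matrix.trace_neg, norm_neg] at this
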